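/- Consider first-order logic with equality over the vocabulary $\langle <, S\,;\,\mathsf{min},\mathsf{max}\rangle$ of binary strings ($<$ a binary and $S$ a unary relation symbol, $\mathsf{min},\mathsf{max}$ constant symbols). For $n \ge 1$, an $n$-bit string $w = w_1\cdots w_n \in \{0,1\}^n$ is identified with the structure with universe $\{1,\dots,n\}$ in which $<$ is the usual order, $S = \{i : w_i = 1\}$, $\mathsf{min} = 1$ and $\mathsf{max} = n$. A sentence $\varphi$ separates a set $\mathcal A$ of strings from a set $\mathcal B$ of strings if $\varphi$ is true in every $w\in\mathcal A$ and false in every $w\in\mathcal B$. The number of quantifiers of $\varphi$ is the number of occurrences of $\forall$ and $\exists$ in it. Theorem (Many vs. Many, $n$-bit). For every integer $t \ge 2$ there is a constant $C_t$, depending only on $t$, such that the following holds. Let $f, g : \mathbb{N} \to \mathbb{N}$ be functions with $\lim_{n\to\infty} f(n) = \infty$ and $\lim_{n\to\infty} g(n) = \infty$. Then for all $n \ge 1$, every set $\mathcal A$ of exactly $f(n)$ $n$-bit strings can be separated from every set $\mathcal B$, disjoint from $\mathcal A$, of exactly $g(n)$ $n$-bit strings by a sentence with at most $$\log_2(n)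 + \log_t\bigl(f(n)\cdot g(n)\bigr) + C_t$$ quantifiers. (If $f(n)\,g(n)=0$, the term $\log_t(0)$ is read as $0$.) -/

import Mathlib

namespace StringLogic

/-- The function symbols of the vocabulary of binary strings: two constants. -/
inductive StringFun : ℕ → Type
  | min : StringFun 0
  | max : StringFun 0

/-- The relation symbols of the vocabulary of binary strings: a binary symbol `<`
and a unary symbol `S`. -/
inductive StringRel : ℕ → Type
  | lt : StringRel 2
  | S : StringRel 1

/-- The vocabulary `⟨<, S ; min, max⟩` of binary strings. -/
abbrev stringLanguage : FirstOrder.Language.{0, 0} := ⟨StringFun, StringRel⟩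

/-- The structure encoding an `n`-bit string `w` (with `1 ≤ n`): its universe is the set of the
`n` positions, `<` is their linear order, `S` is the set of positions carrying the bit `1`, and
`min`, `max` are the first and the last position. -/
@[reducible] def stringStructure {n : ℕ} [NeZero n] (w : Fin n → Bool) :
    stringLanguage.Structure (Fin n) where
  funMap
    | StringFun.min => fun _ => ⟨0, NeZero.pos n⟩
    | StringFun.max => fun _ => ⟨n - 1, Nat.sub_lt (NeZero.pos n) Nat.one_pos⟩
  RelMap
    | StringRel.lt => fun x => x 0 < x 1
    | StringRel.S => fun x => w (x 0) = true

/-- The sentence `φ` is true in the structure encoding the string `w`. -/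
def Satisfies {n : ℕ} [NeZero n] (w : Fin n → Bool) (φ : stringLanguage.Sentence) : Prop :=
  @FirstOrder.Language.Sentence.Realize stringLanguage (Fin n) (stringStructure w) φ

/-- The number of (occurrences of) quantifiers of a first-order formula. An existential quantifier
`∃` is the abbreviation `¬ ∀ ¬` and hence counts once. -/
def numQuantifiers {L : FirstOrder.Language.{0, 0}} {α : Type} :
    {k : ℕ} → L.BoundedFormula α k → ℕ
  | _, .falsum => 0
  | _, .equal _ _ => 0
  | _, .rel _ _ => 0
  | _, .imp φ ψ => numQuantifiers φ + numQuantifiers ψ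
  | _, .all φ => numQuantifiers φ + 1

/-- The sentence `φ` separates `A` from `B`: it is true for every string of `A` and false for every
string of `B`. -/
def Separates {n : ℕ} [NeZero n] (φ : stringLanguage.Sentence)
    (A B : Finset (Fin n → Bool)) : Prop :=
  (∀ w ∈ A, Satisfies w φ) ∧ ∀ w ∈ B, ¬ Satisfies w φ

end StringLogic

namespace StringLogic

open FirstOrder FirstOrder.Language

/-! ### Pebbled strings and the multi-structural game -/

/-! A strategy in the multi-structural game (`Wins`) yields a separating sentence with one
quantifier per round (`exists_formula_of_wins`), so rounds are counted. If `t ≤ n`, Spoiler pebbles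
`t` distinct positions on the left as markers. Each string of `A`, then each of `B`, writes an
injective base-`t` code of itself by pebbling markers, which costs about `log_t |A| + log_t |B|`
rounds. Boards of different atomic types are already separated, so matching boards now carry a
single string from each side (`wins_of_markers`). All these pairs are played in parallel with one
common round pattern (`wins_of_label`). For one pair, Spoiler pebbles a position where the strings
differ and certifies its location by halving distances in `log₂ n + O(1)` rounds (`wins_of_ne`,
`wins_far`). -/

/-- A string of length `n` with `k` pebbles placed on its positions. -/
abbrev Pebbled (n k : ℕ) := (Fin n → Bool) × (Fin k → Fin n)

/-- Names for the distinguished positions: `inl false` is the first position, `inl true` the last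
position, `inr i` the `i`-th pebble. -/
abbrev Idx (k : ℕ) := Bool ⊕ Fin k

variable {n k : ℕ}

/-- Place one more pebble. -/
def put (p : Pebbled n k) (x : Fin n) : Pebbled n (k + 1) := (p.1, Fin.snoc p.2 x)

/-- Remove the last pebble. -/
def unput (p : Pebbled n (k + 1)) : Pebbled n k := (p.1, fun i => p.2 i.castSucc)

@[simp] lemma unput_put (p : Pebbled n k) (x : Fin n) : unput (put p x) = p := by
  simp [unput, put]

@[simp] lemma put_fst (p : Pebbled n k) (x : Fin n) : (put p x).1 = p.1 := rfl

/-- Every pebbled string in `P` receives a pebble according to `f`. -/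
def respond (f : Pebbled n k → Fin n) (P : Set (Pebbled n k)) : Set (Pebbled n (k + 1)) :=
  {p' | ∃ p ∈ P, p' = put p (f p)}

/-- Every pebbled string in `P` receives a pebble in all possible ways. -/
def spread (P : Set (Pebbled n k)) : Set (Pebbled n (k + 1)) :=
  {p' | ∃ p ∈ P, ∃ x, p' = put p x}

lemma respond_mono (f : Pebbled n k → Fin n) {P P' : Set (Pebbled n k)} (h : P' ⊆ P) :
    respond f P' ⊆ respond f P := fun _ ⟨p, hp, e⟩ => ⟨p, h hp, e⟩

lemma spread_mono {P P' : Set (Pebbled n k)} (h : P' ⊆ P) :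
    spread P' ⊆ spread P := fun _ ⟨p, hp, e⟩ => ⟨p, h hp, e⟩

lemma exists_move (C : Pebbled n k → Prop) (i j : Pebbled n k → Fin n)
    (i' j' : Pebbled n k → ℕ) (q : Pebbled n k) : ∃ x : Fin n,
      (C q → (x : ℕ) = min (i q : ℕ) (i' q)) ∧ (¬ C q → (x : ℕ) = min (j q : ℕ) (j' q)) := by
  by_cases h : C q
  · exact ⟨⟨_, (min_le_left _ (i' q)).trans_lt (i q).2⟩, fun _ => rfl, fun h' => absurd h h'⟩
  · exact ⟨⟨_, (min_le_left _ (j' q)).trans_lt (j q).2⟩, fun h' => absurd h' h, fun _ => rfl⟩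

lemma exists_injOn_code {t : ℕ} (ht : 2 ≤ t) (A : Finset (Fin n → Bool)) :
    ∃ u : (Fin n → Bool) → Fin (Nat.clog t A.card) → Fin t, Set.InjOn u A := by
  have hc : Fintype.card A ≤ Fintype.card (Fin (Nat.clog t A.card) → Fin t) := by
    simpa using Nat.le_pow_clog (by omega) A.card
  obtain ⟨e⟩ := Function.Embedding.nonempty_of_card_le hc
  classical
  refine ⟨fun w => if h : w ∈ A then e ⟨w, h⟩ else fun _ => ⟨0, by omega⟩, fun x hx y hy h => ?_⟩
  have hx' : x ∈ A := hx
  have hy' : y ∈ A := hy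
  simp only [hx', hy', dif_pos] at h
  exact congrArg Subtype.val (e.injective h)

variable [NeZero n]

/-- The position with a given name. -/
def place (p : Pebbled n k) : Idx k → Fin n
  | .inl false => ⟨0, NeZero.pos n⟩
  | .inl true => ⟨n - 1, Nat.sub_lt (NeZero.pos n) Nat.one_pos⟩
  | .inr i => p.2 i

/-- The atomic type of a pebbled string. -/
def atype (p : Pebbled n k) : (Idx k → Idx k → Prop) × (Idx k → Bool) :=
  (fun i j => place p i < place p j, fun i => p.1 (place p i))

/-- The inclusion of names when a pebble is added. -/
def liftIdx : Idx k → Idx (k + 1) := Sum.map id Fin.castSucc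

/-- The name of the last pebble. -/
def lastIdx (k : ℕ) : Idx (k + 1) := .inr (Fin.last k)

lemma place_liftIdx (p : Pebbled n (k + 1)) (i : Idx k) :
    place p (liftIdx i) = place (unput p) i := by
  rcases i with (_ | _) | i <;> rfl

@[simp] lemma place_put_liftIdx (p : Pebbled n k) (x : Fin n) (i : Idx k) :
    place (put p x) (liftIdx i) = place p i := by
  rw [place_liftIdx, unput_put]

@[simp] lemma place_put_lastIdx (p : Pebbled n k) (x : Fin n) :
    place (put p x) (lastIdx k) = x := by
  simp [place, put, lastIdx]

lemma lt_iff_of_atype_eq {p q : Pebbled n k} (h : atype p = atype q) (i j : Idx k) :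
    place p i < place p j ↔ place q i < place q j :=
  iff_of_eq (congrFun (congrFun (congrArg Prod.fst h) i) j)

lemma le_iff_of_atype_eq {p q : Pebbled n k} (h : atype p = atype q) (i j : Idx k) :
    place p i ≤ place p j ↔ place q i ≤ place q j := by
  rw [← not_lt, ← not_lt, lt_iff_of_atype_eq h]

lemma eq_iff_of_atype_eq {p q : Pebbled n k} (h : atype p = atype q) (i j : Idx k) :
    place p i = place p j ↔ place q i = place q j := by
  rw [le_antisymm_iff, le_antisymm_iff, le_iff_of_atype_eq h, le_iff_of_atype_eq h]

lemma bit_eq_of_atype_eq {p q : Pebbled n k} (h : atype p = atype q) (i : Idx k) :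
    p.1 (place p i) = q.1 (place q i) :=
  congrFun (congrArg Prod.snd h) i

lemma atype_unput {p q : Pebbled n (k + 1)} (h : atype p = atype q) :
    atype (unput p) = atype (unput q) := by
  refine Prod.ext ?_ ?_
  · funext i j
    have := lt_iff_of_atype_eq h (liftIdx i) (liftIdx j)
    simp only [place_liftIdx] at this
    exact propext this
  · funext i
    have := bit_eq_of_atype_eq h (liftIdx i)
    simp only [place_liftIdx] at this
    exact this

/-- Spoiler wins the multi-structural game on `P` and `Q` whose rounds are played on the left
(`true`) or on the right (`false`) as prescribed by the list. -/
def Wins : List Bool → ∀ {k : ℕ}, Set (Pebbled n k) → Set (Pebbled n k) → Prop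
  | [], _, P, Q => ∀ p ∈ P, ∀ q ∈ Q, atype p ≠ atype q
  | true :: π, _, P, Q => ∃ f, Wins π (respond f P) (spread Q)
  | false :: π, _, P, Q => ∃ f, Wins π (spread P) (respond f Q)

lemma Wins.mono {π : List Bool} {P P' Q Q' : Set (Pebbled n k)} (h : Wins π P Q)
    (hP : P' ⊆ P) (hQ : Q' ⊆ Q) : Wins π P' Q' := by
  induction π generalizing k with
  | nil => exact fun p hp q hq => h p (hP hp) q (hQ hq)
  | cons b π ih =>
    cases b with
    | true =>
      obtain ⟨f, hf⟩ := h
      exact ⟨f, ih hf (respond_mono f hP) (spread_mono hQ)⟩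
    | false =>
      obtain ⟨f, hf⟩ := h
      exact ⟨f, ih hf (spread_mono hP) (respond_mono f hQ)⟩

lemma Wins.symm {π : List Bool} {P Q : Set (Pebbled n k)} (h : Wins π P Q) :
    Wins (π.map not) Q P := by
  induction π generalizing k with
  | nil => exact fun p hp q hq => (h q hq p hp).symm
  | cons b π ih =>
    cases b with
    | true =>
      obtain ⟨f, hf⟩ := h
      exact ⟨f, ih hf⟩
    | false =>
      obtain ⟨f, hf⟩ := h
      exact ⟨f, ih hf⟩

lemma wins_empty_left (π : List Bool) (Q : Set (Pebbled n k)) : Wins π ∅ Q := by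
  induction π generalizing k with
  | nil => exact fun p hp => hp.elim
  | cons b π ih =>
    cases b with
    | true => exact ⟨fun _ => 0, (ih _).mono (fun _ ⟨_, h, _⟩ => h) subset_rfl⟩
    | false => exact ⟨fun _ => 0, (ih _).mono (fun _ ⟨_, h, _⟩ => h) subset_rfl⟩

lemma wins_empty_right (π : List Bool) (P : Set (Pebbled n k)) : Wins π P ∅ := by
  simpa [Function.comp_def] using (wins_empty_left (π.map not) P).symm

/-- Parallel play: games that can be told apart by a label depending only on the atomic type can
be played simultaneously. -/
lemma wins_of_label {Λ : Type} {π : List Bool} {P Q : Set (Pebbled n k)} (l : Pebbled n k → Λ)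
    (hl : ∀ p q, atype p = atype q → l p = l q)
    (h : ∀ a, Wins π {p ∈ P | l p = a} {q ∈ Q | l q = a}) : Wins π P Q := by
  induction π generalizing k with
  | nil => exact fun p hp q hq e => h (l p) p ⟨hp, rfl⟩ q ⟨hq, (hl p q e).symm⟩ e
  | cons b π ih =>
    cases b with
    | true =>
      choose f hf using h
      -- The label is read off the old pebbles, so the atomic type of the larger board still
      -- determines it.
      refine ⟨fun p => f (l p) p, ih (fun p => l (unput p))
        (fun p q e => hl _ _ (atype_unput e)) fun a => (hf a).mono ?_ ?_⟩
      · rintro _ ⟨⟨p, hp, rfl⟩, e⟩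
        rw [unput_put] at e
        subst e
        exact ⟨p, ⟨hp, rfl⟩, rfl⟩
      · rintro _ ⟨⟨p, hp, x, rfl⟩, e⟩
        rw [unput_put] at e
        exact ⟨p, ⟨hp, e⟩, x, rfl⟩
    | false =>
      choose f hf using h
      refine ⟨fun p => f (l p) p, ih (fun p => l (unput p))
        (fun p q e => hl _ _ (atype_unput e)) fun a => (hf a).mono ?_ ?_⟩
      · rintro _ ⟨⟨p, hp, x, rfl⟩, e⟩
        rw [unput_put] at e
        exact ⟨p, ⟨hp, e⟩, x, rfl⟩
      · rintro _ ⟨⟨p, hp, rfl⟩, e⟩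
        rw [unput_put] at e
        subst e
        exact ⟨p, ⟨hp, rfl⟩, rfl⟩

/-- It suffices to win on each atomic type occurring on both sides. -/
lemma wins_of_atype {π : List Bool} {P Q : Set (Pebbled n k)}
    (h : ∀ p₀ ∈ P, ∀ q₀ ∈ Q, atype p₀ = atype q₀ →
      Wins π {p ∈ P | atype p = atype p₀} {q ∈ Q | atype q = atype q₀}) : Wins π P Q := by
  refine wins_of_label atype (fun _ _ e => e) fun a => ?_
  rcases Set.eq_empty_or_nonempty {p ∈ P | atype p = a} with hP | ⟨p₀, hp₀, rfl⟩
  · rw [hP]; exact wins_empty_left _ _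
  rcases Set.eq_empty_or_nonempty {q ∈ Q | atype q = atype p₀} with hQ | ⟨q₀, hq₀, e⟩
  · rw [hQ]; exact wins_empty_right _ _
  have := h p₀ hp₀ q₀ hq₀ e.symm
  rwa [e] at this

/-! ### Comparing distances by halving -/

/-- The alternating list of a given length starting with `b`. -/
def alternating : Bool → ℕ → List Bool
  | _, 0 => []
  | b, r + 1 => b :: alternating (!b) r

lemma length_alternating (b : Bool) (r : ℕ) : (alternating b r).length = r := by
  induction r generalizing b with
  | zero => rfl
  | succ r ih => simp [alternating, ih]

/-- The distances that can be compared with `r` alternating rounds, the first being played on the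
side with the small distance (first component) or with the large distance (second component). -/
def reach : ℕ → ℕ × ℕ
  | 0 => (1, 1)
  | r + 1 => (2 * (reach r).2 - 1, 2 * (reach r).1)

lemma le_reach (r : ℕ) : 2 ^ r + 1 ≤ (reach (r + 2)).1 ∧ 2 ^ r + 1 ≤ (reach (r + 2)).2 := by
  induction r with
  | zero => simp [reach]
  | succ r ih =>
    rw [reach, pow_succ]
    omega

/-- `p` has distance at least `m` from `i` to `j`. -/
def Far (p : Pebbled n k) (i j : Idx k) (m : ℕ) : Prop :=
  (place p i : ℕ) + m ≤ place p j

/-- A conjunction of lower bounds fails on the right through one interval; pebbling its midpoint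
there leaves a disjunction about the two halves. A disjunction holds on the left through one
interval; pebbling its midpoint leaves a conjunction. Hence the sides alternate, and two intervals
cost no more rounds than one. -/
lemma wins_far (r : ℕ) :
    (∀ (k : ℕ) (P Q : Set (Pebbled n k)) (a b c : Idx k) (m₁ m₂ : ℕ),
      m₁ ≤ (reach r).1 → m₂ ≤ (reach r).1 →
      (∀ p ∈ P, Far p a b m₁ ∧ Far p b c m₂) →
      (∀ q ∈ Q, ¬ (Far q a b m₁ ∧ Far q b c m₂)) → Wins (alternating false r) P Q) ∧
    (∀ (k : ℕ) (P Q : Set (Pebbled n k)) (a b c : Idx k) (m₁ m₂ : ℕ),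
      m₁ ≤ (reach r).2 → m₂ ≤ (reach r).2 → 1 ≤ m₁ → 1 ≤ m₂ →
      (∀ p ∈ P, Far p a b m₁ ∨ Far p b c m₂) →
      (∀ q ∈ Q, ¬ (Far q a b m₁ ∨ Far q b c m₂)) → Wins (alternating true r) P Q) := by
  induction r with
  | zero =>
    constructor
    · intro k P Q a b c m₁ m₂ h₁ h₂ hP hQ p hp q hq e
      have := hP p hp
      have := hQ q hq
      have := lt_iff_of_atype_eq e a b
      have := lt_iff_of_atype_eq e b c
      have := le_iff_of_atype_eq e a b
      have := le_iff_of_atype_eq e b c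
      simp only [Far, Fin.lt_def, Fin.le_def, reach] at *
      omega
    · intro k P Q a b c m₁ m₂ h₁ h₂ h₁' h₂' hP hQ p hp q hq e
      have := hP p hp
      have := hQ q hq
      have := lt_iff_of_atype_eq e a b
      have := lt_iff_of_atype_eq e b c
      simp only [Far, Fin.lt_def, reach] at *
      omega
  | succ r ih =>
    obtain ⟨ihX, ihY⟩ := ih
    constructor
    · intro k P Q a b c m₁ m₂ h₁ h₂ hP hQ
      simp only [reach] at h₁ h₂
      -- Right boards sharing a type with a left board inherit its order of `a`, `b`, `c`.
      refine wins_of_atype fun p₀ hp₀ q₀ hq₀ e₀ => ?_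
      have move : ∀ q : Pebbled n k, ∃ x : Fin n,
          (Far q a b m₁ → (x : ℕ) = min (place q c : ℕ) (place q b + m₂ / 2)) ∧
          (¬ Far q a b m₁ → (x : ℕ) = min (place q b : ℕ) (place q a + m₁ / 2)) :=
        exists_move (Far · a b m₁) (place · c) (place · b) (place · b + m₂ / 2)
          (place · a + m₁ / 2)
      choose g hg using move
      refine ⟨g, ?_⟩
      have hq : ∀ q ∈ {q ∈ Q | atype q = atype q₀},
          ¬ (Far q a b m₁ ∧ Far q b c m₂) ∧ (place q a : ℕ) ≤ place q b ∧
          (place q b : ℕ) ≤ place q c ∧ (1 ≤ m₂ → (place q b : ℕ) < place q c) := by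
        rintro q ⟨hq, e⟩
        have := hP p₀ hp₀
        have := lt_iff_of_atype_eq (e.trans e₀.symm) b c
        have := le_iff_of_atype_eq (e.trans e₀.symm) a b
        have := le_iff_of_atype_eq (e.trans e₀.symm) b c
        refine ⟨hQ q hq, ?_⟩
        simp only [Far, Fin.lt_def, Fin.le_def] at *
        omega
      -- The side of `b` on which the pebble lies reveals which interval is too short.
      refine wins_of_label (fun p => place p (lastIdx k) ≤ place p (liftIdx b))
        (fun p q e => propext (le_iff_of_atype_eq e _ _)) fun s => ?_
      by_cases hs : s
      · rw [eq_true hs]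
        by_cases hm : m₁ = 0
        · refine (wins_empty_right _ _).mono subset_rfl ?_
          rintro _ ⟨⟨q, hqQ, rfl⟩, e⟩
          have e' := of_eq_true e
          have := hq q hqQ
          have := hg q
          simp only [Far, place_put_lastIdx, place_put_liftIdx, Fin.le_def] at *
          omega
        -- The bounds add up to `m₁ + 1`: a gap of at least `m₁` cannot miss both, while a shorter
        -- gap cut at `m₁ / 2` misses both.
        · refine ihY _ _ _ (liftIdx a) (lastIdx k) (liftIdx b) (m₁ / 2 + 1) (m₁ - m₁ / 2)
            (by omega) (by omega) (by omega) (by omega) ?_ ?_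
          · rintro _ ⟨⟨p, hp, x, rfl⟩, -⟩
            have := hP p hp.1
            simp only [Far, place_put_lastIdx, place_put_liftIdx] at *
            omega
          · rintro _ ⟨⟨q, hqQ, rfl⟩, e⟩
            have e' := of_eq_true e
            have := hq q hqQ
            have := hg q
            simp only [Far, place_put_lastIdx, place_put_liftIdx, Fin.le_def] at *
            omega
      · rw [eq_false hs]
        by_cases hm : m₂ ≤ 1
        · refine (wins_empty_right _ _).mono subset_rfl ?_
          rintro _ ⟨⟨q, hqQ, rfl⟩, e⟩
          have e' := of_eq_false e
          have := hq q hqQ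
          have := hg q
          simp only [Far, place_put_lastIdx, place_put_liftIdx, Fin.le_def] at *
          omega
        · refine ihY _ _ _ (liftIdx b) (lastIdx k) (liftIdx c) (m₂ / 2 + 1) (m₂ - m₂ / 2)
            (by omega) (by omega) (by omega) (by omega) ?_ ?_
          · rintro _ ⟨⟨p, hp, x, rfl⟩, -⟩
            have := hP p hp.1
            simp only [Far, place_put_lastIdx, place_put_liftIdx] at *
            omega
          · rintro _ ⟨⟨q, hqQ, rfl⟩, e⟩
            have e' := of_eq_false e
            have := hq q hqQ
            have := hg q
            simp only [Far, place_put_lastIdx, place_put_liftIdx, Fin.le_def] at *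
            omega
    · intro k P Q a b c m₁ m₂ h₁ h₂ h₁' h₂' hP hQ
      simp only [reach] at h₁ h₂
      have move : ∀ q : Pebbled n k, ∃ x : Fin n,
          (Far q a b m₁ → (x : ℕ) = min (place q b : ℕ) (place q a + m₁ / 2)) ∧
          (¬ Far q a b m₁ → (x : ℕ) = min (place q c : ℕ) (place q b + m₂ / 2)) :=
        exists_move (Far · a b m₁) (place · b) (place · c) (place · a + m₁ / 2)
          (place · b + m₂ / 2)
      choose g hg using move
      refine ⟨g, ?_⟩
      -- Since `m₁ / 2 < m₁`, a midpoint of the first interval lies strictly before `b`.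
      refine wins_of_label (fun p => place p (lastIdx k) < place p (liftIdx b))
        (fun p q e => propext (lt_iff_of_atype_eq e _ _)) fun s => ?_
      by_cases hs : s
      · rw [eq_true hs]
        refine ihX _ _ _ (liftIdx a) (lastIdx k) (liftIdx b) (m₁ / 2) (m₁ - m₁ / 2)
            (by omega) (by omega) ?_ ?_
        · rintro _ ⟨⟨p, hp, rfl⟩, e'⟩
          replace e' := of_eq_true e'
          have := hP p hp
          have := hg p
          simp only [Far, place_put_lastIdx, place_put_liftIdx, Fin.lt_def] at *
          omega
        · rintro _ ⟨⟨q, hq, x, rfl⟩, -⟩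
          have := hQ q hq
          simp only [Far, place_put_lastIdx, place_put_liftIdx] at *
          omega
      · rw [eq_false hs]
        refine ihX _ _ _ (liftIdx b) (lastIdx k) (liftIdx c) (m₂ / 2) (m₂ - m₂ / 2)
            (by omega) (by omega) ?_ ?_
        · rintro _ ⟨⟨p, hp, rfl⟩, e'⟩
          replace e' := of_eq_false e'
          have := hP p hp
          have := hg p
          simp only [Far, place_put_lastIdx, place_put_liftIdx, Fin.lt_def] at *
          omega
        · rintro _ ⟨⟨q, hq, x, rfl⟩, -⟩
          have := hQ q hq
          simp only [Far, place_put_lastIdx, place_put_liftIdx] at *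
          omega

/-- Two distinct strings, pebbled arbitrarily, are told apart in `log₂ n + O(1)` rounds. -/
lemma wins_of_ne {P Q : Set (Pebbled n k)} {w w' : Fin n → Bool} (hw : w ≠ w')
    (hP : ∀ p ∈ P, p.1 = w) (hQ : ∀ q ∈ Q, q.1 = w') {r : ℕ} (hr : n ≤ 2 ^ r) :
    Wins (true :: alternating false (r + 2)) P Q := by
  obtain ⟨i, hi⟩ := Function.ne_iff.1 hw
  have := le_reach r
  refine ⟨fun _ => i, wins_of_atype ?_⟩
  rintro _ ⟨p, hp, rfl⟩ q₀ - e
  -- The two bounds sum to `n - 1`, so only the pebble at `i` meets both; the differing bit excludes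
  -- it on the right.
  refine (wins_far (r + 2)).1 _ _ _ (.inl false) (lastIdx k) (.inl true) i (n - 1 - i)
    (by omega) (by omega) ?_ ?_
  · rintro _ ⟨⟨p, hp, rfl⟩, -⟩
    rw [Far, Far, place_put_lastIdx]
    simp only [place]
    omega
  · rintro _ ⟨⟨q, hq, x, rfl⟩, e'⟩
    have hb := bit_eq_of_atype_eq (e.trans e'.symm) (lastIdx k)
    rw [place_put_lastIdx, place_put_lastIdx, put_fst, put_fst, hP p hp, hQ q hq] at hb
    rw [Far, Far, place_put_lastIdx]
    simp only [place]
    rintro ⟨h₁, h₂⟩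
    have hx : x = i := Fin.ext (by omega)
    subst hx
    exact hi hb

/-! ### Labelling strings by pebbles -/

/-- Place `m` more pebbles. -/
def putMany {m : ℕ} (p : Pebbled n k) (y : Fin m → Fin n) : Pebbled n (k + m) :=
  (p.1, Fin.append p.2 y)

lemma wins_replicate_true {m : ℕ} {π : List Bool} {P Q : Set (Pebbled n k)}
    (F : Pebbled n k → Fin m → Fin n)
    (h : Wins π {p' | ∃ p ∈ P, p' = putMany p (F p)} {q' | ∃ q ∈ Q, ∃ y, q' = putMany q y}) :
    Wins (List.replicate m true ++ π) P Q := by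
  induction m generalizing π with
  | zero =>
    refine h.mono (fun p hp => ⟨p, hp, ?_⟩) (fun q hq => ⟨q, hq, Fin.elim0, ?_⟩)
    · rw [putMany, Subsingleton.elim (F p) Fin.elim0, Fin.append_elim0]; rfl
    · rw [putMany, Fin.append_elim0]; rfl
  | succ m ih =>
    rw [List.replicate_succ', List.append_assoc]
    have key : ∀ (p : Pebbled n k) (y : Fin m → Fin n) (x : Fin n),
        put (putMany p y) x = putMany p (Fin.snoc y x : Fin (m + 1) → Fin n) := fun p y x =>
      Prod.ext rfl (Fin.append_snoc p.2 y x).symm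
    refine ih (fun p i => F p i.castSucc)
      -- The last move is computed from the original board, recovered by forgetting the new pebbles.
      ⟨fun p' => F (p'.1, fun i => p'.2 (Fin.castAdd m i)) (Fin.last m), h.mono ?_ ?_⟩
    · rintro _ ⟨_, ⟨p, hp, rfl⟩, rfl⟩
      refine ⟨p, hp, ?_⟩
      have e : (((putMany p fun i : Fin m => F p i.castSucc).1,
          fun i => (putMany p fun i : Fin m => F p i.castSucc).2 (Fin.castAdd m i)) :
            Pebbled n k) = p := by
        refine Prod.ext rfl (funext fun i => ?_)
        simp [putMany]
      change put _ (F (_, _) _) = _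
      rw [e, key]
      congr 1
      exact Fin.snoc_init_self (F p)
    · rintro _ ⟨_, ⟨q, hq, y, rfl⟩, x, rfl⟩
      exact ⟨q, hq, _, key q y x⟩

lemma wins_replicate_false {m : ℕ} {π : List Bool} {P Q : Set (Pebbled n k)}
    (F : Pebbled n k → Fin m → Fin n)
    (h : Wins π {p' | ∃ p ∈ P, ∃ y, p' = putMany p y} {q' | ∃ q ∈ Q, q' = putMany q (F q)}) :
    Wins (List.replicate m false ++ π) P Q := by
  simpa [Function.comp_def] using (wins_replicate_true F h.symm).symm

/-- Equalities between code pebbles and markers are part of the atomic type, so within one type the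
codes, and hence the strings, agree. -/
lemma wins_of_markers {t a b : ℕ} {P Q : Set (Pebbled n k)} (M : Fin t → Fin k)
    (hM : ∀ p ∈ P, Function.Injective fun i => p.2 (M i)) {A B : Finset (Fin n → Bool)}
    (hAB : Disjoint A B) (hP : ∀ p ∈ P, p.1 ∈ A) (hQ : ∀ q ∈ Q, q.1 ∈ B)
    (u : (Fin n → Bool) → Fin a → Fin t) (hu : Set.InjOn u A)
    (v : (Fin n → Bool) → Fin b → Fin t) (hv : Set.InjOn v B) {r : ℕ} (hr : n ≤ 2 ^ r) :
    Wins (List.replicate a true ++ (List.replicate b false ++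
      (true :: alternating false (r + 2)))) P Q := by
  refine wins_replicate_true (fun p i => p.2 (M (u p.1 i))) ?_
  refine wins_replicate_false (fun q i => q.2 (Fin.castAdd a (M (v q.1 i)))) ?_
  refine wins_of_atype ?_
  rintro _ ⟨_, ⟨p₀, hp₀, rfl⟩, z₀, rfl⟩ _ ⟨_, ⟨q₀, hq₀, y₀, rfl⟩, rfl⟩ e
  refine wins_of_ne (w := p₀.1) (w' := q₀.1)
    (fun h => Finset.disjoint_left.1 hAB (hP p₀ hp₀) (h ▸ hQ q₀ hq₀)) ?_ ?_ hr
  · rintro _ ⟨⟨_, ⟨p, hp, rfl⟩, z, rfl⟩, e'⟩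
    refine hu (hP p hp) (hP p₀ hp₀) (funext fun i => hM p₀ hp₀ ?_)
    have := eq_iff_of_atype_eq e' (.inr (Fin.castAdd b (Fin.natAdd k i)))
      (.inr (Fin.castAdd b (Fin.castAdd a (M (u p.1 i)))))
    simp [place, putMany] at this
    exact this.symm
  · rintro _ ⟨⟨_, ⟨q, hq, y, rfl⟩, rfl⟩, e'⟩
    refine hv (hQ q hq) (hQ q₀ hq₀) (funext fun i => hM p₀ hp₀ ?_)
    -- Distinct markers are assumed only on the left, so both right codes are compared through `p₀`.
    have h₁ := eq_iff_of_atype_eq (e'.trans e.symm) (.inr (Fin.natAdd (k + a) i))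
      (.inr (Fin.castAdd b (Fin.castAdd a (M (v q.1 i)))))
    have h₂ := eq_iff_of_atype_eq e (.inr (Fin.natAdd (k + a) i))
      (.inr (Fin.castAdd b (Fin.castAdd a (M (v q₀.1 i)))))
    simp [place, putMany] at h₁ h₂
    exact h₁.symm.trans h₂

/-- The strings of `A` without pebbles. -/
def bare (A : Finset (Fin n → Bool)) : Set (Pebbled n 0) := {p | p.1 ∈ A}

lemma wins_bare {t : ℕ} (ht : 2 ≤ t) (htn : t ≤ n) {A B : Finset (Fin n → Bool)}
    (hAB : Disjoint A B) :
    Wins (List.replicate t true ++ (List.replicate (Nat.clog t A.card) true ++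
      (List.replicate (Nat.clog t B.card) false ++
        (true :: alternating false (Nat.clog 2 n + 2))))) (bare A) (bare B) := by
  obtain ⟨u, hu⟩ := exists_injOn_code ht A
  obtain ⟨v, hv⟩ := exists_injOn_code ht B
  refine wins_replicate_true (fun _ i => Fin.castLE htn i)
    (wins_of_markers (fun i => Fin.natAdd 0 i) ?_ hAB ?_ ?_ u hu v hv
      (Nat.le_pow_clog (by omega) n))
  · rintro _ ⟨p, hp, rfl⟩ i j h
    simpa only [putMany, Fin.append_right, (Fin.castLE_injective htn).eq_iff] using h
  · rintro _ ⟨p, hp, rfl⟩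
    exact hp
  · rintro _ ⟨q, hq, y, rfl⟩
    exact hq

/-- For strings shorter than `t`: pebbling every position in order forces the matching pebbles on
the right to be the identity, exposing all bits. -/
lemma wins_bare_of_length {A B : Finset (Fin n → Bool)} (hAB : Disjoint A B) :
    Wins (List.replicate n true ++ []) (bare A) (bare B) := by
  refine wins_replicate_true (fun _ i => i) ?_
  rintro _ ⟨p, hp, rfl⟩ _ ⟨q, hq, y, rfl⟩ e
  have hy : StrictMono y := fun i j hij => by
    have := lt_iff_of_atype_eq e (.inr (Fin.natAdd 0 i)) (.inr (Fin.natAdd 0 j))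
    simp only [place, putMany, Fin.append_right] at this
    exact this.1 hij
  obtain rfl := hy.eq_id
  refine Finset.disjoint_left.1 hAB hp ?_
  have : p.1 = q.1 := funext fun i => by
    have := bit_eq_of_atype_eq e (.inr (Fin.natAdd 0 i))
    simp only [place, putMany, Fin.append_right] at this
    exact this
  rw [this]
  exact hq

/-! ### From winning strategies to sentences -/

/-- Truth of a formula in a pebbled string. -/
def Holds (p : Pebbled n k) (φ : stringLanguage.BoundedFormula Empty k) : Prop :=
  letI := stringStructure p.1
  φ.Realize default p.2

lemma holds_imp (p : Pebbled n k) (φ ψ : stringLanguage.BoundedFormula Empty k) :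
    Holds p (φ.imp ψ) ↔ (Holds p φ → Holds p ψ) := Iff.rfl

lemma holds_not (p : Pebbled n k) (φ : stringLanguage.BoundedFormula Empty k) :
    Holds p φ.not ↔ ¬ Holds p φ := Iff.rfl

/-- The term naming a distinguished position. -/
def nameTerm : Idx k → stringLanguage.Term (Empty ⊕ Fin k)
  | .inl false => .func (l := 0) StringFun.min Fin.elim0
  | .inl true => .func (l := 0) StringFun.max Fin.elim0
  | .inr i => .var (.inr i)

/-- `i < j` as a formula. -/
def ltFormula (i j : Idx k) : stringLanguage.BoundedFormula Empty k :=
  .rel (l := 2) StringRel.lt ![nameTerm i, nameTerm j]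

/-- `S i` as a formula. -/
def bitFormula (i : Idx k) : stringLanguage.BoundedFormula Empty k :=
  .rel (l := 1) StringRel.S ![nameTerm i]

lemma realize_nameTerm (p : Pebbled n k) (i : Idx k) :
    @Term.realize stringLanguage (Fin n) (stringStructure p.1) _
      (Sum.elim (default : Empty → Fin n) p.2) (nameTerm i) = place p i := by
  rcases i with (_ | _) | i <;> rfl

lemma holds_ltFormula (p : Pebbled n k) (i j : Idx k) :
    Holds p (ltFormula i j) ↔ place p i < place p j := by
  rw [← realize_nameTerm, ← realize_nameTerm]
  rfl

lemma holds_bitFormula (p : Pebbled n k) (i : Idx k) :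
    Holds p (bitFormula i) ↔ p.1 (place p i) = true := by
  rw [← realize_nameTerm]
  rfl

/-- A set of pebbled strings is definable without quantifiers. -/
def QFDefinable (D : Set (Pebbled n k)) : Prop :=
  ∃ φ : stringLanguage.BoundedFormula Empty k, numQuantifiers φ = 0 ∧ ∀ p, Holds p φ ↔ p ∈ D

lemma QFDefinable.compl {D : Set (Pebbled n k)} (h : QFDefinable D) : QFDefinable Dᶜ := by
  obtain ⟨φ, h₀, h⟩ := h
  exact ⟨φ.not, by simpa [BoundedFormula.not, numQuantifiers] using h₀,
    fun p => not_congr (h p)⟩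

lemma QFDefinable.union {D E : Set (Pebbled n k)} (hD : QFDefinable D) (hE : QFDefinable E) :
    QFDefinable (D ∪ E) := by
  obtain ⟨φ, h₀, h⟩ := hD
  obtain ⟨ψ, g₀, g⟩ := hE
  refine ⟨φ.not.imp ψ, by simp [numQuantifiers, h₀, g₀], fun p => ?_⟩
  rw [holds_imp, holds_not, h, g, Set.mem_union, or_iff_not_imp_left]

lemma QFDefinable.iUnion {ι : Type} [Finite ι] {D : ι → Set (Pebbled n k)}
    (h : ∀ i, QFDefinable (D i)) : QFDefinable (⋃ i, D i) := by
  have : ∀ s : Set ι, s.Finite → QFDefinable (⋃ i ∈ s, D i) := fun s hs => by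
    induction s, hs using Set.Finite.induction_on with
    | empty => exact ⟨.falsum, rfl, fun p => by simp; exact id⟩
    | insert _ _ ih => rw [Set.biUnion_insert]; exact (h _).union ih
  simpa using this Set.univ Set.finite_univ

lemma QFDefinable.iInter {ι : Type} [Finite ι] {D : ι → Set (Pebbled n k)}
    (h : ∀ i, QFDefinable (D i)) : QFDefinable (⋂ i, D i) := by
  rw [← compl_compl (⋂ i, D i), Set.compl_iInter]
  exact (QFDefinable.iUnion fun i => (h i).compl).compl

lemma QFDefinable.iff {D : Set (Pebbled n k)} (h : QFDefinable D) (b : Prop) :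
    QFDefinable {p | p ∈ D ↔ b} := by
  by_cases hb : b
  · simp only [hb, iff_true]
    exact h
  · simp only [hb, iff_false]
    exact h.compl

lemma qfDefinable_atype (p₀ : Pebbled n k) :
    QFDefinable {p : Pebbled n k | atype p = atype p₀} := by
  have h₁ : ∀ i j : Idx k, QFDefinable {p : Pebbled n k | place p i < place p j} :=
    fun i j => ⟨ltFormula i j, rfl, fun p => holds_ltFormula p i j⟩
  have h₂ : ∀ i : Idx k, QFDefinable {p : Pebbled n k | p.1 (place p i) = true} :=
    fun i => ⟨bitFormula i, rfl, fun p => holds_bitFormula p i⟩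
  have key : {p : Pebbled n k | atype p = atype p₀} =
      ((⋂ i, ⋂ j, {p : Pebbled n k | p ∈ {p : Pebbled n k | place p i < place p j} ↔
        place p₀ i < place p₀ j})ᶜ ∪
      (⋂ i, {p : Pebbled n k | p ∈ {p : Pebbled n k | p.1 (place p i) = true} ↔
        p₀.1 (place p₀ i) = true})ᶜ)ᶜ := by
    ext p
    rw [Set.compl_union, compl_compl, compl_compl]
    simp only [Set.mem_inter_iff, Set.mem_iInter, Set.mem_ofPred_eq]
    refine ⟨fun e => ⟨lt_iff_of_atype_eq e, fun i => by rw [bit_eq_of_atype_eq e]⟩, fun h => ?_⟩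
    exact Prod.ext (funext fun i => funext fun j => propext (h.1 i j))
      (funext fun i => Bool.eq_iff_iff.2 (h.2 i))
  rw [key]
  exact ((QFDefinable.iInter fun i => QFDefinable.iInter fun j => (h₁ i j).iff _).compl.union
    (QFDefinable.iInter fun i => (h₂ i).iff _).compl).compl

/-- A left round becomes `∃`, a right round `∀`. At the end, the disjunction of the left atomic
types separates; it is finite because there are finitely many boards. -/
lemma exists_formula_of_wins {π : List Bool} {P Q : Set (Pebbled n k)} (h : Wins π P Q) :
    ∃ φ : stringLanguage.BoundedFormula Empty k, numQuantifiers φ = π.length ∧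
      (∀ p ∈ P, Holds p φ) ∧ ∀ q ∈ Q, ¬ Holds q φ := by
  induction π generalizing k with
  | nil =>
    obtain ⟨φ, h₀, hφ⟩ := QFDefinable.iUnion (ι := P) fun p => qfDefinable_atype p.1
    refine ⟨φ, h₀, fun p hp => (hφ p).2 (Set.mem_iUnion.2 ⟨⟨p, hp⟩, rfl⟩), fun q hq hφq => ?_⟩
    obtain ⟨p, e⟩ := Set.mem_iUnion.1 ((hφ q).1 hφq)
    exact h p.1 p.2 q hq e.symm
  | cons b π ih =>
    cases b with
    | true =>
      obtain ⟨f, hf⟩ := h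
      obtain ⟨φ, h₀, hP, hQ⟩ := ih hf
      refine ⟨φ.not.all.not, by simp [numQuantifiers, h₀],
        fun p hp hn => hn (f p) (hP _ ⟨p, hp, rfl⟩), fun q hq hn => hn fun x hx => ?_⟩
      exact hQ _ ⟨q, hq, x, rfl⟩ hx
    | false =>
      obtain ⟨f, hf⟩ := h
      obtain ⟨φ, h₀, hP, hQ⟩ := ih hf
      exact ⟨φ.all, by simp [numQuantifiers, h₀],
        fun p hp x => hP _ ⟨p, hp, x, rfl⟩, fun q hq hn => hQ _ ⟨q, hq, rfl⟩ (hn (f q))⟩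

lemma exists_sentence_of_wins {π : List Bool} {A B : Finset (Fin n → Bool)}
    (h : Wins π (bare A) (bare B)) :
    ∃ φ : stringLanguage.Sentence, Separates φ A B ∧ numQuantifiers φ = π.length := by
  obtain ⟨φ, h₀, hA, hB⟩ := exists_formula_of_wins h
  have key : ∀ w : Fin n → Bool, Holds (w, default) φ ↔ Satisfies w φ := fun w =>
    iff_of_eq (congrArg₂
      (@BoundedFormula.Realize stringLanguage (Fin n) (stringStructure w) Empty 0 φ)
      (Subsingleton.elim _ _) (Subsingleton.elim _ _))
  exact ⟨φ, ⟨fun w hw => (key w).1 (hA (w, default) hw),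
    fun w hw hs => hB (w, default) hw ((key w).2 hs)⟩, h₀⟩

lemma clog_le_logb_add_one (b : ℕ) {m : ℕ} (hb : 2 ≤ b) (hm : 1 ≤ m) :
    (Nat.clog b m : ℝ) ≤ Real.logb b m + 1 := by
  rw [← Real.natCeil_logb_natCast]
  exact (Nat.ceil_lt_add_one (Real.logb_nonneg (by exact_mod_cast hb) (by exact_mod_cast hm))).le

end StringLogic

open StringLogic in
theorem mainTheorem10 (t : ℕ) (ht : 2 ≤ t) :
    ∃ C : ℝ, ∀ f g : ℕ → ℕ,
      Filter.Tendsto f Filter.atTop Filter.atTop →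
      Filter.Tendsto g Filter.atTop Filter.atTop →
      ∀ (n : ℕ) [NeZero n] (A B : Finset (Fin n → Bool)),
        A.card = f n → B.card = g n → Disjoint A B →
        ∃ φ : StringLogic.stringLanguage.Sentence,
          StringLogic.Separates φ A B ∧
          (StringLogic.numQuantifiers φ : ℝ) ≤
            Real.logb 2 n + Real.logb t ((f n : ℝ) * (g n : ℝ)) + C := by
  -- `t` markers, one round for the differing position, two spare halving rounds, and three
  -- roundings of logarithms.
  refine ⟨t + 6, fun f g _ _ n _ A B hA hB hAB => ?_⟩
  rw [← hA, ← hB]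
  have hn : 1 ≤ n := NeZero.pos n
  have ht1 : (1 : ℝ) < t := by exact_mod_cast ht
  have ht0 : (0 : ℝ) ≤ t := by positivity
  have hlog : 0 ≤ Real.logb 2 n := Real.logb_nonneg (by norm_num) (by exact_mod_cast hn)
  rcases Finset.eq_empty_or_nonempty A with rfl | hA'
  · obtain ⟨φ, hφ, h₀⟩ := exists_sentence_of_wins (π := []) (A := ∅) (B := B)
      (fun p hp => absurd hp (Finset.notMem_empty _))
    refine ⟨φ, hφ, ?_⟩
    simp [h₀]
    linarith
  rcases Finset.eq_empty_or_nonempty B with rfl | hB'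
  · obtain ⟨φ, hφ, h₀⟩ := exists_sentence_of_wins (π := []) (A := A) (B := ∅)
      (fun p _ q hq => absurd hq (Finset.notMem_empty _))
    refine ⟨φ, hφ, ?_⟩
    simp [h₀]
    linarith
  have hA1 : 1 ≤ A.card := hA'.card_pos
  have hB1 : 1 ≤ B.card := hB'.card_pos
  have hmul := Real.logb_mul (b := t) (x := A.card) (y := B.card)
    (by positivity) (by positivity)
  have hlA : 0 ≤ Real.logb t A.card := Real.logb_nonneg ht1 (by exact_mod_cast hA1)
  have hlB : 0 ≤ Real.logb t B.card := Real.logb_nonneg ht1 (by exact_mod_cast hB1)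
  rw [hmul]
  rcases le_or_gt t n with htn | hnt
  · obtain ⟨φ, hφ, h₀⟩ := exists_sentence_of_wins (wins_bare ht htn hAB)
    refine ⟨φ, hφ, ?_⟩
    have h₁ := clog_le_logb_add_one t ht hA1
    have h₂ := clog_le_logb_add_one t ht hB1
    have h₃ := clog_le_logb_add_one 2 le_rfl hn
    rw [h₀]
    simp only [List.length_append, List.length_replicate, List.length_cons, length_alternating]
    push_cast at h₃ ⊢
    linarith
  · obtain ⟨φ, hφ, h₀⟩ := exists_sentence_of_wins (wins_bare_of_length hAB)
    refine ⟨φ, hφ, ?_⟩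
    have h₁ : (n : ℝ) ≤ t := by exact_mod_cast hnt.le
    rw [h₀]
    simp only [List.length_append, List.length_replicate, List.length_nil, add_zero]
    linarith
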